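/- Let $d\ge 0$ be an integer, and index the entries of a row vector $f\in\mathbb C^{2d+1}$ from the centre, $f=(f_{-d},\dots,f_d)$, with $f_m=0$ for $|m|>d$. Let $v^d_j$ ($|j|\le d$) be the standard basis vectors and, for $\varepsilon=\pm1$, put $u^{d,\varepsilon}_j=\tfrac12\bigl(v^d_j+\varepsilon(-1)^d v^d_{-j}\bigr)$. *The operators.* Use coordinates $x_1,x_2,x_3\in\mathbb R$, $y_1,y_2>0$ for the products $xy$, where $x$ is upper triangular unipotent with $x_{12}=x_2$, $x_{23}=x_1$, $x_{13}=x_3$, and $y=\mathrm{diag}(y_1y_2,y_1,1)$. Let $$Z_{\pm2}=(2y_2\partial_{y_2}-y_1\partial_{y_1})\pm2i\,y_2\partial_{x_2},\qquad Z_{\pm1}=-2i\,y_1(\partial_{x_1}+x_2\partial_{x_3})\mp2y_1y_2\partial_{x_3},\qquad Z_0=-\sqrt6\,y_1\partial_{y_1}.$$ For $|a|,|j|\le2$ let $C^{d,a}_{m,j}=\langle 2\,j\;d\,m\,|\,(d+a)\,(j+m)\rangle$ be the Clebsch–Gordan coefficient (zero outside its usual range), let $$(B^d_{-2},\dots,B^d_2)=\tfrac{\sqrt6}{3}\bigl(-2(d+1),-(d+3),-3,d-2,2d\bigr),$$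 and let $\widetilde Y^{d,a}_{m',j}$ be $C^{d,a}_{m'-j,j}$ times $Z_{-2}-m'-2$, $Z_{-1}$, $Z_0-B^d_a$, $Z_1$, $Z_2+m'-2$ for $j=-2,-1,0,1,2$ respectively. For a smooth $\mathbb C^{2d+1}$-valued function $F$ of $(x,y)$, the $\mathbb C^{2d+2a+1}$-valued function $Y^aF$ has the entries $(Y^aF)_{m'}=\sum_{j=-2}^2\widetilde Y^{d,a}_{m',j}F_{m'-j}$, $|m'|\le d+a$. For $\mu\in\mathbb C^3$ with $\mu_1+\mu_2+\mu_3=0$, let $\rho=(1,0,-1)$, $p_{\rho+\mu}(y)=y_1^{1-\mu_3}y_2^{1+\mu_1}$ and $p_{-\rho-\mu}=1/p_{\rho+\mu}$, and define $Y^a_\mu:\mathbb C^{2d+1}\to\mathbb C^{2d+2a+1}$ by $Y^a_\mu f=p_{-\rho-\mu}\,Y^a(p_{\rho+\mu}f)$, which is constant in $(x,y)$. (A space of negative dimension is read as $0$.) *The vectors.* Put $g_1=-\sqrt6(1+\mu_3)u^{2,+}_2+(\mu_1-\mu_2-1)u^{2,+}_0\in\mathbb C^5$. Put $g^d_{2,0,0}=\tfrac12$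 and, for $0<2j+k\le d$ with $j,k\ge0$, $$g^d_{2,k,2j+k}=(-1)^j\prod_{i=0}^{j-1}\frac{\sqrt{(d-1-2i-k)(d-2i-k)}\;(3\mu_3+2d-1+2i+k)}{\sqrt{(d+1+2i+k)(d+2+2i+k)}\;(\mu_1-\mu_2-1-2i-k)}.$$ For $\delta\in\{0,1\}$ and $\varepsilon=\pm1$ let $$g_2^{d,\delta,\varepsilon}=\sum_{0\le 2j+\delta\le d}g^d_{2,\delta,2j+\delta}\,u^{d,\varepsilon}_{2j+\delta},\qquad g_3^{d,\delta,\varepsilon}=\sum_{0\le 2j+\delta\le d}g^d_{3,\delta,2j+\delta}\,u^{d,\varepsilon}_{2j+\delta},$$ where $g^d_{3,\delta,m}=g^d_{2,\delta,m}$ for $m<d$ and $g^d_{3,\delta,d}=g^d_{2,\delta,d-2}/\sqrt{d(2d-1)}$ (used for $d\ge2$). For $d$ odd and $\kappa=\frac{d+1}2$ let $$g_4^{d,\varepsilon}=\sum_{\kappa\le2j+\kappa\le d}g^d_{2,\kappa,2j+\kappa}\,u^{d,\varepsilon}_{2j+\kappa}.$$ **Proposition.** Suppose that $\mu$ is in the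 unitary standard form, i.e. either $\mu=(it_1,it_2,-i(t_1+t_2))$ with $t_1,t_2\in\mathbb R$ and $t_1-t_2,\,2t_1+t_2,\,t_1+2t_2\ne0$, or $\mu=(x+it,-2it,-x+it)$ with $x,t\in\mathbb R$, $x\ge0$. If $f\in\mathbb C^{2d+1}$ satisfies $Y^{-1}_\mu f=0$ and $Y^{-2}_\mu f=0$, then at least one of the following is true: 1. $f=0$; 2. $d\in\{0,1\}$; 3. $d=2$ and $f$ is a multiple of $g_1$; 4. $\mu=\bigl(\frac{d-1}2+it,-2it,-\frac{d-1}2+it\bigr)$ for some $t\in\mathbb R$, with either $d$ even or $t\ne0$, and $f$ is a linear combination of $g_2^{d,0,\varepsilon}$ and $g_2^{d,1,-\varepsilon}$, where $\varepsilon=(-1)^d$; 5. $d$ is odd, $\mu=\bigl(\frac{d-1}2,0,-\frac{d-1}2\bigr)$, and $f$ is a linear combination of $g_2^{d,\delta,\varepsilon}$, $g_4^{d,+}$ and $g_4^{d,-}$, where $\kappa=\frac{d+1}2$, $\delta\in\{0,1\}$, $\delta\equiv\kappa+1\pmod2$ and $\varepsilon=(-1)^\kappa$; 6. $\mu=(d-1,0,1-d)$,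 and $f$ is a linear combination of $g_3^{d,1,\varepsilon}$, $g_3^{d,0,\varepsilon}$, $u^{d,+}_d$ and $u^{d,-}_d$, where $\varepsilon=(-1)^d$. -/

import Mathlib

open scoped Nat

noncomputable section

namespace GLThree

/-! ### Vectors indexed from the central entry -/

/-- The space `ℂ^{2d+1}` of row vectors, with entries indexed from the centre by
`m ∈ {-d, …, d}` (the zero space if `d < 0`). -/
abbrev CVec (d : ℤ) : Type := Set.Icc (-d) d → ℂ

/-- The entry `f_m`, with the convention `f_m = 0` for `|m| > d`. -/
def entry {d : ℤ} (f : CVec d) (m : ℤ) : ℂ :=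
  if h : m ∈ Set.Icc (-d) d then f ⟨m, h⟩ else 0

/-- The standard basis vector `v^d_j`. -/
def vVec (d : ℕ) (j : ℤ) : CVec d := fun m => if (m : ℤ) = j then 1 else 0

/-- The vector `u^{d,ε}_j = (v^d_j + ε (-1)^d v^d_{-j}) / 2`, where `ε = ±1`. -/
def uVec (d : ℕ) (ε : ℂ) (j : ℤ) : CVec d :=
  (1 / 2 : ℂ) • (vVec d j + (ε * (-1) ^ d) • vVec d (-j))

/-! ### Clebsch-Gordan coefficients -/

/-- The factorial of an integer (used at non-negative integers only). -/
def ifact (n : ℤ) : ℝ := (n.toNat ! : ℝ)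

/-- The common square-root factor of the Clebsch-Gordan coefficients with `k = 2`. -/
def cgRoot (d a m i : ℤ) : ℝ :=
  Real.sqrt ((2 * d + 2 * a + 1) * ifact (2 * d + a - 2)) /
      Real.sqrt (ifact (2 - i) * ifact (2 + i) * ifact (2 * d + a + 3)) *
    (if a ≤ 0 then
      (-1) ^ i * Real.sqrt (ifact (d - m) * ifact (d + m)) /
        Real.sqrt (ifact (d + a - i - m) * ifact (d + a + i + m))
    else
      Real.sqrt (ifact (d + a - i - m) * ifact (d + a + i + m)) /
        Real.sqrt (ifact (d - m) * ifact (d + m)))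

/-- The Clebsch-Gordan coefficient `⟨2 i d m | (d+a) (i+m)⟩` for `|a| ≤ 2`, in closed form
(Condon-Shortley convention). It is zero unless
`|m| ≤ d`, `|i| ≤ 2`, `|m + i| ≤ d + a` and `|d - 2| ≤ d + a ≤ d + 2`. -/
def cg (d a m i : ℤ) : ℝ :=
  if |m| ≤ d ∧ |i| ≤ 2 ∧ |m + i| ≤ d + a ∧ |d - 2| ≤ d + a ∧ d + a ≤ d + 2 then
    (if a = -2 ∨ a = 2 then 2 * Real.sqrt 6
     else if a = -1 then 2 * Real.sqrt 6 * (i * (d + 1) + 2 * m)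
     else if a = 1 then 2 * Real.sqrt 6 * (d * i - 2 * m)
     else 2 * (2 * d ^ 2 * (i ^ 2 - 1) + d * (5 * i ^ 2 + 6 * i * m - 2)
            + 3 * (i + m) * (i + 2 * m)))
      * cgRoot d a m i
  else 0

/-- The vector of constants `(√6/3) (-2(d+1), -(d+3), -3, d-2, 2d)`, indexed by `-2 ≤ a ≤ 2`. -/
def cgB (d a : ℤ) : ℝ :=
  Real.sqrt 6 / 3 *
    (if a = -2 then -2 * (d + 1) else if a = -1 then -(d + 3) else if a = 0 then -3
     else if a = 1 then d - 2 else 2 * d)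

/-! ### Differential operators on the upper triangular group `U(ℝ) Y⁺` -/

/-- The coordinates of the point `x y` of `U(ℝ) Y⁺`, where `x` is the upper triangular unipotent
matrix with rows `(1, x₂, x₃)`, `(0, 1, x₁)`, `(0, 0, 1)` and `y = diag(y₁ y₂, y₁, 1)`. The points
of the group are those with `0 < y₁` and `0 < y₂`. -/
@[ext] structure UY where
  x1 : ℝ
  x2 : ℝ
  x3 : ℝ
  y1 : ℝ
  y2 : ℝ

def dx1 (F : UY → ℂ) (p : UY) : ℂ := deriv (fun s : ℝ => F { p with x1 := s }) p.x1
def dx2 (F : UY → ℂ) (p : UY) : ℂ := deriv (fun s : ℝ => F { p with x2 := s }) p.x2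
def dx3 (F : UY → ℂ) (p : UY) : ℂ := deriv (fun s : ℝ => F { p with x3 := s }) p.x3
def dy1 (F : UY → ℂ) (p : UY) : ℂ := deriv (fun s : ℝ => F { p with y1 := s }) p.y1
def dy2 (F : UY → ℂ) (p : UY) : ℂ := deriv (fun s : ℝ => F { p with y2 := s }) p.y2

/-- The operators `Z_j`, `|j| ≤ 2`:
`Z_{±2} = (2 y₂ ∂_{y₂} - y₁ ∂_{y₁}) ± 2 i y₂ ∂_{x₂}`,
`Z_{±1} = -2 i y₁ (∂_{x₁} + x₂ ∂_{x₃}) ∓ 2 y₁ y₂ ∂_{x₃}`,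
`Z_0 = -√6 y₁ ∂_{y₁}`. -/
def Zop (j : ℤ) (F : UY → ℂ) (p : UY) : ℂ :=
  if j = 2 ∨ j = -2 then
    (2 * p.y2 * dy2 F p - p.y1 * dy1 F p) + (j.sign : ℂ) * (2 * Complex.I * p.y2 * dx2 F p)
  else if j = 1 ∨ j = -1 then
    -2 * Complex.I * p.y1 * (dx1 F p + p.x2 * dx3 F p)
      - (j.sign : ℂ) * (2 * p.y1 * p.y2 * dx3 F p)
  else -(Real.sqrt 6 : ℂ) * p.y1 * dy1 F p

/-- The operators `Ỹ^{d,a}_{m',j}`, for `|a|, |j| ≤ 2`. -/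
def Ytilde (d a m' j : ℤ) (F : UY → ℂ) (p : UY) : ℂ :=
  (cg d a (m' - j) j : ℂ) *
    (if j = -2 then Zop (-2) F p + (-m' - 2) * F p
     else if j = -1 then Zop (-1) F p
     else if j = 0 then Zop 0 F p - (cgB d a : ℂ) * F p
     else if j = 1 then Zop 1 F p
     else Zop 2 F p + (m' - 2) * F p)

/-- The operator `Y^a`, `|a| ≤ 2`, from `ℂ^{2d+1}`-valued to `ℂ^{2d+2a+1}`-valued functions:
`(Y^a F)_{m'} = ∑_{j=-2}^{2} Ỹ^{d,a}_{m',j} F_{m'-j}`. -/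
def Yop (d a : ℤ) (F : UY → CVec d) : UY → CVec (d + a) := fun p m' =>
  ∑ j ∈ Finset.Icc (-2 : ℤ) 2, Ytilde d a m' j (fun q => entry (F q) (m' - j)) p

/-- `ρ = (1, 0, -1)`. -/
def rho : Fin 3 → ℂ := ![1, 0, -1]

/-- The power function `p_ν(x y) = y₁^{-ν₃} y₂^{ν₁}`, for `ν₁ + ν₂ + ν₃ = 0`; this is
`|a₁|^{ν₁} |a₂|^{ν₂} |a₃|^{ν₃}` at `y = diag(a₁, a₂, a₃) = diag(y₁ y₂, y₁, 1)`. -/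
def powFun (ν : Fin 3 → ℂ) (p : UY) : ℂ := (p.y1 : ℂ) ^ (-ν 2) * (p.y2 : ℂ) ^ (ν 0)

/-- The identity of `U(ℝ) Y⁺`. -/
def UY.base : UY := ⟨0, 0, 0, 1, 1⟩

/-- The action on the power function, `Y^a_μ f = p_{-ρ-μ} Y^a (p_{ρ+μ} f)`. The right-hand side
does not depend on the point of `U(ℝ) Y⁺` (see `YMu_eq`); it is evaluated at the identity. -/
def YMu (d a : ℤ) (μ : Fin 3 → ℂ) (f : CVec d) : CVec (d + a) :=
  powFun (-rho - μ) UY.base • Yop d a (fun q => powFun (rho + μ) q • f) UY.base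

lemma hasDerivAt_ofReal_cpow {s : ℝ} (hs : 0 < s) (c : ℂ) :
    HasDerivAt (fun r : ℝ => (r : ℂ) ^ c) (c * (s : ℂ) ^ (c - 1)) s := by
  have h := (hasDerivAt_id (s : ℂ)).cpow_const (c := c) (Or.inl (by simpa using hs))
  simpa using h.comp_ofReal

lemma mul_cpow_sub_one {s : ℝ} (hs : 0 < s) (c : ℂ) :
    (s : ℂ) * (s : ℂ) ^ (c - 1) = (s : ℂ) ^ c := by
  have h : (s : ℂ) ≠ 0 := by exact_mod_cast hs.ne'
  rw [Complex.cpow_sub _ _ h, Complex.cpow_one]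
  field_simp

lemma dy1_powFun (ν : Fin 3 → ℂ) (c : ℂ) {p : UY} (h1 : 0 < p.y1) :
    (p.y1 : ℂ) * dy1 (fun q => powFun ν q * c) p = -ν 2 * (powFun ν p * c) := by
  have h := ((hasDerivAt_ofReal_cpow h1 (-ν 2)).mul_const ((p.y2 : ℂ) ^ (ν 0))).mul_const c
  simp only [dy1, powFun]
  rw [h.deriv, ← mul_cpow_sub_one h1 (-ν 2)]
  ring

lemma dy2_powFun (ν : Fin 3 → ℂ) (c : ℂ) {p : UY} (h2 : 0 < p.y2) :
    (p.y2 : ℂ) * dy2 (fun q => powFun ν q * c) p = ν 0 * (powFun ν p * c) := by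
  have h := ((hasDerivAt_ofReal_cpow h2 (ν 0)).const_mul ((p.y1 : ℂ) ^ (-ν 2))).mul_const c
  simp only [dy2, powFun]
  rw [h.deriv, ← mul_cpow_sub_one h2 (ν 0)]
  ring

/-- The eigenvalues of the operators `Z_j` on the power function `p_ν`. -/
def Zeig (j : ℤ) (ν : Fin 3 → ℂ) : ℂ :=
  if j = 2 ∨ j = -2 then 2 * ν 0 + ν 2
  else if j = 1 ∨ j = -1 then 0
  else (Real.sqrt 6 : ℂ) * ν 2

lemma Zop_powFun (j : ℤ) (ν : Fin 3 → ℂ) (c : ℂ) {p : UY} (h1 : 0 < p.y1) (h2 : 0 < p.y2) :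
    Zop j (fun q => powFun ν q * c) p = powFun ν p * (Zeig j ν * c) := by
  have e1 := dy1_powFun ν c h1
  have e2 := dy2_powFun ν c h2
  have a1 : dx1 (fun q => powFun ν q * c) p = 0 := by simp [dx1, powFun]
  have a2 : dx2 (fun q => powFun ν q * c) p = 0 := by simp [dx2, powFun]
  have a3 : dx3 (fun q => powFun ν q * c) p = 0 := by simp [dx3, powFun]
  unfold Zop Zeig
  rw [a1, a2, a3]
  split_ifs
  · linear_combination 2 * e2 - e1
  · ring
  · linear_combination -(Real.sqrt 6 : ℂ) * e1

lemma powFun_neg_mul (ν : Fin 3 → ℂ) {p : UY} (h1 : 0 < p.y1) (h2 : 0 < p.y2) :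
    powFun (-ν) p * powFun ν p = 1 := by
  have k1 : (p.y1 : ℂ) ≠ 0 := by exact_mod_cast h1.ne'
  have k2 : (p.y2 : ℂ) ≠ 0 := by exact_mod_cast h2.ne'
  simp only [powFun, Pi.neg_apply, neg_neg]
  rw [Complex.cpow_neg, Complex.cpow_neg]
  have l1 : (p.y1 : ℂ) ^ (ν 2) ≠ 0 := by simp [Complex.cpow_eq_zero_iff, k1]
  have l2 : (p.y2 : ℂ) ^ (ν 0) ≠ 0 := by simp [Complex.cpow_eq_zero_iff, k2]
  field_simp

lemma entry_smul {d : ℤ} (c : ℂ) (f : CVec d) (m : ℤ) : entry (c • f) m = c * entry f m := by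
  unfold entry
  split_ifs <;> simp

lemma Ytilde_powFun (d a m' j : ℤ) (ν : Fin 3 → ℂ) (c : ℂ) {p : UY}
    (h1 : 0 < p.y1) (h2 : 0 < p.y2) :
    powFun (-ν) p * Ytilde d a m' j (fun q => powFun ν q * c) p =
      (cg d a (m' - j) j : ℂ) *
        (if j = -2 then Zeig (-2) ν + (-m' - 2)
         else if j = -1 then Zeig (-1) ν
         else if j = 0 then Zeig 0 ν - (cgB d a : ℂ)
         else if j = 1 then Zeig 1 ν
         else Zeig 2 ν + (m' - 2)) * c := by
  have h := powFun_neg_mul ν h1 h2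
  simp only [Ytilde, Zop_powFun _ ν c h1 h2]
  split_ifs
  · linear_combination ((cg d a (m' - j) j : ℂ) * (Zeig (-2) ν + (-m' - 2)) * c) * h
  · linear_combination ((cg d a (m' - j) j : ℂ) * Zeig (-1) ν * c) * h
  · linear_combination ((cg d a (m' - j) j : ℂ) * (Zeig 0 ν - (cgB d a : ℂ)) * c) * h
  · linear_combination ((cg d a (m' - j) j : ℂ) * Zeig 1 ν * c) * h
  · linear_combination ((cg d a (m' - j) j : ℂ) * (Zeig 2 ν + (m' - 2)) * c) * h

/-- `p_{-ρ-μ} Y^a (p_{ρ+μ} f)` is constant on `U(ℝ) Y⁺`, with value `Y^a_μ f`. -/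
theorem YMu_eq (d a : ℤ) (μ : Fin 3 → ℂ) (f : CVec d) (p : UY) (h1 : 0 < p.y1) (h2 : 0 < p.y2) :
    powFun (-rho - μ) p • Yop d a (fun q => powFun (rho + μ) q • f) p = YMu d a μ f := by
  have key : ∀ q : UY, 0 < q.y1 → 0 < q.y2 → ∀ m' : Set.Icc (-(d + a)) (d + a),
      (powFun (-rho - μ) q • Yop d a (fun q => powFun (rho + μ) q • f) q) m' =
      ∑ j ∈ Finset.Icc (-2 : ℤ) 2, (cg d a (m' - j) j : ℂ) *
        (if j = -2 then Zeig (-2) (rho + μ) + (-(m' : ℤ) - 2)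
         else if j = -1 then Zeig (-1) (rho + μ)
         else if j = 0 then Zeig 0 (rho + μ) - (cgB d a : ℂ)
         else if j = 1 then Zeig 1 (rho + μ)
         else Zeig 2 (rho + μ) + ((m' : ℤ) - 2)) * entry f (m' - j) := by
    intro q k1 k2 m'
    have e : -rho - μ = -(rho + μ) := by ring
    rw [e, Pi.smul_apply, smul_eq_mul, Yop, Finset.mul_sum]
    refine Finset.sum_congr rfl fun j _ => ?_
    simp only [entry_smul]
    exact Ytilde_powFun d a m' j (rho + μ) (entry f (m' - j)) k1 k2
  funext m'
  rw [key p h1 h2 m', YMu, key UY.base (by simp [UY.base]) (by simp [UY.base]) m']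

/-! ### The parameters and the explicit vectors -/

/-- The unitary standard form of the spectral parameters: either `μ = (i t₁, i t₂, -i (t₁ + t₂))`
with distinct coordinates, or `μ = (x + i t, -2 i t, -x + i t)` with `x ≥ 0`. -/
def UnitaryStandardForm (μ : Fin 3 → ℂ) : Prop :=
  (∃ t1 t2 : ℝ, t1 - t2 ≠ 0 ∧ 2 * t1 + t2 ≠ 0 ∧ t1 + 2 * t2 ≠ 0 ∧
      μ = ![Complex.I * t1, Complex.I * t2, -Complex.I * (t1 + t2)]) ∨
  (∃ x t : ℝ, 0 ≤ x ∧ μ = ![x + Complex.I * t, -2 * Complex.I * t, -x + Complex.I * t])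

/-- The vector `g₁` (used for `d = 2`). -/
def g1 (d : ℕ) (μ : Fin 3 → ℂ) : CVec d :=
  (-(Real.sqrt 6 : ℂ) * (1 + μ 2)) • uVec d 1 2 + (μ 0 - μ 1 - 1) • uVec d 1 0

/-- The coefficient `g^d_{2,k,2j+k}`, for `2 j + k ≤ d`. -/
def g2coef (d : ℕ) (μ : Fin 3 → ℂ) (k j : ℕ) : ℂ :=
  if 2 * j + k = 0 then 1 / 2
  else (-1) ^ j * ∏ i ∈ Finset.range j,
    ((Real.sqrt (((d : ℝ) - 1 - 2 * i - k) * ((d : ℝ) - 2 * i - k)) : ℂ)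
        * (3 * μ 2 + 2 * d - 1 + 2 * i + k)) /
      ((Real.sqrt (((d : ℝ) + 1 + 2 * i + k) * ((d : ℝ) + 2 + 2 * i + k)) : ℂ)
        * (μ 0 - μ 1 - 1 - 2 * i - k))

/-- The vector `g₂^{d,δ,ε}`. -/
def g2 (d : ℕ) (μ : Fin 3 → ℂ) (δ : ℕ) (ε : ℂ) : CVec d :=
  ∑ j ∈ (Finset.range (d + 1)).filter (fun j => 2 * j + δ ≤ d),
    g2coef d μ δ j • uVec d ε (2 * j + δ : ℕ)

/-- The coefficient `g^d_{3,δ,2j+δ}`, for `2 j + δ ≤ d` and `d ≥ 2`: as for `g₂`, except that the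
coefficient of index `d` is `g^d_{2,δ,d-2} / √(d (2d - 1))`. -/
def g3coef (d : ℕ) (μ : Fin 3 → ℂ) (δ j : ℕ) : ℂ :=
  if 2 * j + δ = d then g2coef d μ δ (j - 1) / (Real.sqrt ((d : ℝ) * (2 * d - 1)) : ℂ)
  else g2coef d μ δ j

/-- The vector `g₃^{d,δ,ε}`. -/
def g3 (d : ℕ) (μ : Fin 3 → ℂ) (δ : ℕ) (ε : ℂ) : CVec d :=
  ∑ j ∈ (Finset.range (d + 1)).filter (fun j => 2 * j + δ ≤ d),
    g3coef d μ δ j • uVec d ε (2 * j + δ : ℕ)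

/-- The vector `g₄^{d,ε}`, for `d` odd: as for `g₂`, with `κ = (d + 1) / 2` in place of `δ`. -/
def g4 (d : ℕ) (μ : Fin 3 → ℂ) (ε : ℂ) : CVec d := g2 d μ ((d + 1) / 2) ε

end GLThree

end

/-! Write h_m = √((d-m)!(d+m)!) f_m, A = μ₀ - μ₁ and B = 3μ₂ + 2d - 2. On a power function the
operators Z_{±1} act as zero, and the square roots in the Clebsch-Gordan coefficients split into a
factor of the target index, a constant depending on the shift, and the weight of the source index.
So Y^{-1}_μ f = 0 and Y^{-2}_μ f = 0 become rational three-term recurrences linking h_{m-2}, h_m,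
h_{m+2}. Eliminating either outer term (`two_term_sub`, `two_term_add`) leaves two relations for
each neighbouring pair: (A - 1 + m) h_{m-2} + (B + 1 - m) h_m = 0 and (B - 1 + m) h_{m-2} + (A + 1 -
m) h_m = 0. Their determinant A² - B² does not depend on m, and it equals -4 (μ₀ - μ₂ - (d-1)) (μ₁ -
μ₂ - (d-1)). If it is nonzero, every pair satisfying both relations vanishes. This leaves f = 0 for
d ≥ 3 and the line of g₁ for d = 2. If it is zero, a solution is propagated outwards from the centre
by an explicit ratio, and the relation between h_{-1} and h_1 fixes the symmetry of the odd-index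
entries. A vanishing denominator A - 1 - m breaks the chain and frees new parameters. For A = B this
happens only when t = 0 and d is odd, which gives g₄; in the case μ₁ - μ₂ = d - 1 it happens only at
the last step, which frees the entries at ±d. -/

namespace GLThree

/-! ### Rescaling that makes the Clebsch-Gordan coefficients rational -/

/-- The weight `√((d-m)! (d+m)!)`, which clears the square roots in the equations. -/
noncomputable def weight (d m : ℤ) : ℝ := Real.sqrt (ifact (d - m) * ifact (d + m))

/-- The entries of `f`, rescaled by `weight`. -/
noncomputable def scaledEntry {d : ℤ} (f : CVec d) (m : ℤ) : ℂ := (weight d m : ℂ) * entry f m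

lemma ifact_pos (n : ℤ) : 0 < ifact n := by
  unfold ifact
  exact_mod_cast Nat.factorial_pos _

lemma ifact_add_one {n : ℤ} (hn : 0 ≤ n) : ifact (n + 1) = (n + 1) * ifact n := by
  lift n to ℕ using hn
  have : ((n : ℤ) + 1).toNat = n + 1 := by omega
  simp [ifact, this, Nat.factorial_succ]

/-- No bound on m is needed: `ifact` is 1 at negative integers, so rescaling is invertible at every
index. -/
lemma weight_pos (d m : ℤ) : 0 < weight d m :=
  Real.sqrt_pos.2 (mul_pos (ifact_pos _) (ifact_pos _))

lemma weight_ne_zero (d m : ℤ) : (weight d m : ℂ) ≠ 0 := by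
  exact_mod_cast (weight_pos d m).ne'

lemma entry_eq_zero {d : ℤ} (f : CVec d) {m : ℤ} (h : ¬ |m| ≤ d) : entry f m = 0 := by
  rw [abs_le] at h
  exact dif_neg h

lemma scaledEntry_eq_zero_iff {d : ℤ} (f : CVec d) (m : ℤ) :
    scaledEntry f m = 0 ↔ entry f m = 0 := by
  rw [scaledEntry, mul_eq_zero, or_iff_right (weight_ne_zero d m)]

lemma entry_add {d : ℤ} (f g : CVec d) (m : ℤ) : entry (f + g) m = entry f m + entry g m := by
  unfold entry
  split_ifs <;> simp

/-- The reflection `m ↦ -m` of the weight. -/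
lemma weight_neg (d m : ℤ) : weight d (-m) = weight d m := by
  unfold weight
  rw [mul_comm]
  congr 3; ring

/-- Consecutive weights differ by exactly the quotient of square roots in the coefficients of g₂, so
the recurrence for h turns into the one for f. -/
lemma weight_add_two (d m : ℤ) (h1 : -d ≤ m) (h2 : m ≤ d - 2) :
    weight d (m + 2) * Real.sqrt (((d : ℝ) - 1 - m) * (d - m)) =
      weight d m * Real.sqrt (((d : ℝ) + 1 + m) * (d + 2 + m)) := by
  unfold weight
  have p1 : 0 ≤ ifact (d - (m + 2)) * ifact (d + (m + 2)) :=
    (mul_pos (ifact_pos _) (ifact_pos _)).le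
  have p2 : 0 ≤ ifact (d - m) * ifact (d + m) := (mul_pos (ifact_pos _) (ifact_pos _)).le
  rw [← Real.sqrt_mul p1, ← Real.sqrt_mul p2]
  congr 1
  have e1 : d - m = (d - (m + 2)) + 1 + 1 := by ring
  have e2 : d + (m + 2) = (d + m) + 1 + 1 := by ring
  rw [e2, ifact_add_one (by omega), ifact_add_one (by omega), e1,
    ifact_add_one (by omega), ifact_add_one (by omega)]
  push_cast
  ring

/-- The factor of the Clebsch-Gordan coefficients that depends only on the target index. -/
noncomputable def cgScale (d a m' : ℤ) : ℝ :=
  Real.sqrt ((2 * d + 2 * a + 1) * ifact (2 * d + a - 2)) / Real.sqrt (ifact (2 * d + a + 3)) /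
    weight (d + a) m'

lemma cgScale_pos {d a m' : ℤ} (h : 0 ≤ d + a) : 0 < cgScale d a m' := by
  unfold cgScale
  have : (0 : ℝ) < 2 * d + 2 * a + 1 := by
    have : (0 : ℝ) ≤ d + a := by exact_mod_cast h
    linarith
  have := weight_pos (d + a) m'
  have := ifact_pos (2 * d + a - 2)
  have := ifact_pos (2 * d + a + 3)
  positivity

/-- The factorials at d ± (m'-i) see only the source index and those at d + a ± m' only the target
index. The target factor is common to all terms of an equation and can be cancelled. -/
lemma cgRoot_eq {d a : ℤ} (ha : a ≤ 0) (m' i : ℤ) :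
    cgRoot d a (m' - i) i = cgScale d a m' * ((-1) ^ i / Real.sqrt (ifact (2 - i) * ifact (2 + i)))
      * weight d (m' - i) := by
  have p1 : 0 ≤ ifact (2 - i) * ifact (2 + i) := (mul_pos (ifact_pos _) (ifact_pos _)).le
  unfold cgRoot cgScale weight
  rw [if_pos ha, Real.sqrt_mul p1]
  have e1 : d + a - i - (m' - i) = d + a - m' := by ring
  have e2 : d + a + i + (m' - i) = d + a + m' := by ring
  rw [e1, e2]
  field_simp

lemma cg_neg_two_mul_entry {d : ℤ} (hd : 2 ≤ d) (f : CVec d) {m' i : ℤ} (hm : |m'| ≤ d - 2)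
    (hi : |i| ≤ 2) :
    (cg d (-2) (m' - i) i : ℂ) * entry f (m' - i) =
      ((2 * Real.sqrt 6 * cgScale d (-2) m' : ℝ) : ℂ) *
        (((-1) ^ i / Real.sqrt (ifact (2 - i) * ifact (2 + i)) : ℝ) : ℂ) *
          scaledEntry f (m' - i) := by
  by_cases h : |m' - i| ≤ d
  · have hc : |m' - i| ≤ d ∧ |i| ≤ 2 ∧ |m' - i + i| ≤ d + -2 ∧ |d - 2| ≤ d + -2 ∧ d + -2 ≤ d + 2 :=
      ⟨h, hi, by rw [sub_add_cancel]; omega, by rw [abs_of_nonneg (by omega)]; omega, by omega⟩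
    rw [cg, if_pos hc, if_pos (by simp), cgRoot_eq (by norm_num), scaledEntry]
    push_cast
    ring
  · simp [scaledEntry, entry_eq_zero f h]

lemma cg_neg_one_mul_entry {d : ℤ} (hd : 2 ≤ d) (f : CVec d) {m' i : ℤ} (hm : |m'| ≤ d - 1)
    (hi : |i| ≤ 2) :
    (cg d (-1) (m' - i) i : ℂ) * entry f (m' - i) =
      ((2 * Real.sqrt 6 * cgScale d (-1) m' : ℝ) : ℂ) *
        (((-1) ^ i / Real.sqrt (ifact (2 - i) * ifact (2 + i)) : ℝ) : ℂ) *
          ((i * (d - 1) + 2 * m') * scaledEntry f (m' - i)) := by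
  by_cases h : |m' - i| ≤ d
  · have hc : |m' - i| ≤ d ∧ |i| ≤ 2 ∧ |m' - i + i| ≤ d + -1 ∧ |d - 2| ≤ d + -1 ∧ d + -1 ≤ d + 2 :=
      ⟨h, hi, by rw [sub_add_cancel]; omega, by rw [abs_of_nonneg (by omega)]; omega, by omega⟩
    rw [cg, if_pos hc, if_neg (by decide), if_pos rfl, cgRoot_eq (by norm_num), scaledEntry]
    push_cast
    ring
  · simp [scaledEntry, entry_eq_zero f h]

lemma YMu_apply (d a : ℤ) (μ : Fin 3 → ℂ) (f : CVec d) (m' : Set.Icc (-(d + a)) (d + a)) :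
    YMu d a μ f m' =
      (2 * (rho + μ) 0 + (rho + μ) 2 - (m' : ℤ) - 2) *
          ((cg d a (m' - -2) (-2) : ℂ) * entry f (m' - -2)) +
        (Real.sqrt 6 * (rho + μ) 2 - cgB d a) * ((cg d a (m' - 0) 0 : ℂ) * entry f (m' - 0)) +
        (2 * (rho + μ) 0 + (rho + μ) 2 + (m' : ℤ) - 2) *
          ((cg d a (m' - 2) 2 : ℂ) * entry f (m' - 2)) := by
  have e : -rho - μ = -(rho + μ) := by ring
  rw [YMu, e, Pi.smul_apply, smul_eq_mul, Yop, Finset.mul_sum]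
  simp only [entry_smul]
  rw [Finset.sum_congr rfl fun j _ => Ytilde_powFun d a m' j (rho + μ) (entry f (m' - j))
    (p := UY.base) (by simp [UY.base]) (by simp [UY.base])]
  have hs : Finset.Icc (-2 : ℤ) 2 = {-2, -1, 0, 1, 2} := by decide
  rw [hs]
  simp [Zeig]
  ring

/-! ### Three-term and two-term recurrences -/

section Relations

variable {d : ℕ} {μ : Fin 3 → ℂ} {f : CVec d}

lemma sqrt_ifact_two : Real.sqrt (ifact 4 * ifact 0) = 2 * Real.sqrt 6 := by
  have h : ifact 4 * ifact 0 = 2 ^ 2 * 6 := by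
    simp [ifact, Nat.factorial]
    norm_num
  rw [h, Real.sqrt_mul (by norm_num), Real.sqrt_sq (by norm_num)]

lemma sqrt_ifact_zero : Real.sqrt (ifact 2 * ifact 2) = 2 := by
  rw [Real.sqrt_mul_self (ifact_pos _).le]
  simp [ifact]

lemma sqrt_six_sq : (Real.sqrt 6 : ℂ) * Real.sqrt 6 = 6 := by
  exact_mod_cast Real.mul_self_sqrt (by norm_num : (0 : ℝ) ≤ 6)

lemma sqrt_six_ne_zero : (Real.sqrt 6 : ℂ) ≠ 0 := by
  intro h
  have := sqrt_six_sq
  simp [h] at this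

lemma three_term_neg_two (hd : 2 ≤ d) (hμ : μ 0 + μ 1 + μ 2 = 0)
    (h2 : YMu d (-2) μ f = 0) {m : ℤ} (hm : |m| ≤ d - 2) :
    (μ 0 - μ 1 - m - 1) * scaledEntry f (m + 2) + 2 * (3 * μ 2 + 2 * d - 1) * scaledEntry f m
      + (μ 0 - μ 1 + m - 1) * scaledEntry f (m - 2) = 0 := by
  have hd' : (2 : ℤ) ≤ d := by exact_mod_cast hd
  have hm' := abs_le.1 hm
  have h := congrFun h2 ⟨m, by constructor <;> omega⟩
  rw [YMu_apply] at h
  simp only [cg_neg_two_mul_entry hd' f hm (i := -2) (by norm_num),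
    cg_neg_two_mul_entry hd' f hm (i := 0) (by norm_num),
    cg_neg_two_mul_entry hd' f hm (i := 2) (by norm_num)] at h
  norm_num [sqrt_ifact_two, sqrt_ifact_zero, mul_comm (ifact 0), rho, cgB,
    -mul_eq_zero] at h
  have hK : (cgScale d (-2) m : ℂ) ≠ 0 := by
    exact_mod_cast (cgScale_pos (by omega)).ne'
  have h6 := sqrt_six_ne_zero
  have h66 := sqrt_six_sq
  have hi := inv_mul_cancel₀ h6
  have hμ1 : μ 1 = -μ 0 - μ 2 := by linear_combination hμ
  refine (mul_eq_zero.1 ?_).resolve_left hK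
  rw [hμ1]
  -- The terms i = ±2 carry √6/√6 and the term i = 0 carries √6·√6, so all square roots disappear.
  simp only [Matrix.cons_val] at h
  linear_combination h - cgScale d (-2) m * ((1 + 2 * μ 0 + μ 2 - m - 2) * scaledEntry f (m + 2)
    + (1 + 2 * μ 0 + μ 2 + m - 2) * scaledEntry f (m - 2)) * hi
    - cgScale d (-2) m * (μ 2 - 1 + 2 / 3 * (d + 1)) * scaledEntry f m * h66

lemma three_term_neg_one (hd : 2 ≤ d) (hμ : μ 0 + μ 1 + μ 2 = 0)
    (h1 : YMu d (-1) μ f = 0) {m : ℤ} (hm : |m| ≤ d - 1) :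
    (m - d + 1) * (μ 0 - μ 1 - m - 1) * scaledEntry f (m + 2)
      + 2 * m * (3 * μ 2 + d) * scaledEntry f m
      + (m + d - 1) * (μ 0 - μ 1 + m - 1) * scaledEntry f (m - 2) = 0 := by
  have hd' : (2 : ℤ) ≤ d := by exact_mod_cast hd
  have hm' := abs_le.1 hm
  have h := congrFun h1 ⟨m, by constructor <;> omega⟩
  rw [YMu_apply] at h
  simp only [cg_neg_one_mul_entry hd' f hm (i := -2) (by norm_num),
    cg_neg_one_mul_entry hd' f hm (i := 0) (by norm_num),
    cg_neg_one_mul_entry hd' f hm (i := 2) (by norm_num)] at h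
  norm_num [sqrt_ifact_two, sqrt_ifact_zero, mul_comm (ifact 0), rho, cgB,
    -mul_eq_zero] at h
  have hK : (cgScale d (-1) m : ℂ) ≠ 0 := by
    exact_mod_cast (cgScale_pos (by omega)).ne'
  have h6 := sqrt_six_ne_zero
  have h66 := sqrt_six_sq
  have hi := inv_mul_cancel₀ h6
  have hμ1 : μ 1 = -μ 0 - μ 2 := by linear_combination hμ
  refine (mul_eq_zero.1 ?_).resolve_left hK
  rw [hμ1]
  simp only [Matrix.cons_val] at h
  linear_combination h / 2 - cgScale d (-1) m *
    ((m - d + 1) * (1 + 2 * μ 0 + μ 2 - m - 2) * scaledEntry f (m + 2)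
      + (m + d - 1) * (1 + 2 * μ 0 + μ 2 + m - 2) * scaledEntry f (m - 2)) * hi
    - cgScale d (-1) m * (μ 2 - 1 + (d + 3) / 3) * m * scaledEntry f m * h66

/-- Elimination of `h_{m+2}`; at `m = d - 1` this term is absent. -/
lemma two_term_sub (hd : 2 ≤ d) (hμ : μ 0 + μ 1 + μ 2 = 0)
    (h1 : YMu d (-1) μ f = 0) (h2 : YMu d (-2) μ f = 0) {m : ℤ}
    (hm : 2 - d ≤ m) (hm' : m ≤ d - 1) :
    (μ 0 - μ 1 - 1 + m) * scaledEntry f (m - 2)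
      + (3 * μ 2 + 2 * d - 1 - m) * scaledEntry f m = 0 := by
  have hd1 : (d : ℂ) - 1 ≠ 0 := by
    rw [sub_ne_zero]
    exact_mod_cast (by omega : d ≠ 1)
  have e1 := three_term_neg_one hd hμ h1 (m := m) (abs_le.2 (by omega))
  refine (mul_eq_zero.1 ?_).resolve_left hd1
  rcases hm'.lt_or_eq with hlt | heq
  · have e2 := three_term_neg_two hd hμ h2 (m := m) (abs_le.2 (by omega))
    -- The coefficient m - d + 1 of h_{m+2} cancels, and d - 1 factors out of the two remaining
    -- coefficients.
    linear_combination (e1 + (d - 1 - m) * e2) / 2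
  -- The index m = d - 1 is outside the range of the a = -2 equation, but here the a = -1 equation
  -- alone has zero coefficient at h_{m+2}.
  · have hc : (m : ℂ) = d - 1 := by rw [heq]; push_cast; rfl
    rw [hc] at e1 ⊢
    linear_combination e1 / 2

/-- Elimination of `h_{m-2}`; at `m = 1 - d` this term is absent. -/
lemma two_term_add (hd : 2 ≤ d) (hμ : μ 0 + μ 1 + μ 2 = 0)
    (h1 : YMu d (-1) μ f = 0) (h2 : YMu d (-2) μ f = 0) {m : ℤ}
    (hm : 1 - d ≤ m) (hm' : m ≤ d - 2) :
    (μ 0 - μ 1 - 1 - m) * scaledEntry f (m + 2)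
      + (3 * μ 2 + 2 * d - 1 + m) * scaledEntry f m = 0 := by
  have hd1 : (d : ℂ) - 1 ≠ 0 := by
    rw [sub_ne_zero]
    exact_mod_cast (by omega : d ≠ 1)
  have e1 := three_term_neg_one hd hμ h1 (m := m) (abs_le.2 (by omega))
  refine (mul_eq_zero.1 ?_).resolve_left hd1
  rcases hm.lt_or_eq with hlt | heq
  · have e2 := three_term_neg_two hd hμ h2 (m := m) (abs_le.2 (by omega))
    linear_combination (-e1 + (d - 1 + m) * e2) / 2
  · have hc : (m : ℂ) = 1 - d := by rw [← heq]; push_cast; rfl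
    rw [hc] at e1 ⊢
    linear_combination -e1 / 2

end Relations

/-! ### Entries of the explicit vectors -/

section Entries

variable {d : ℕ}

lemma cvec_ext {f g : CVec d} (h : ∀ n : ℕ, n ≤ d → entry f n = entry g n ∧
    entry f (-n) = entry g (-n)) : f = g := by
  funext ⟨m, hm⟩
  have e : ∀ f' : CVec d, f' ⟨m, hm⟩ = entry f' m := fun f' => by rw [entry, dif_pos hm]
  rw [e f, e g]
  have h1 := hm.1
  have h2 := hm.2
  rcases Int.eq_nat_or_neg m with ⟨n, rfl | rfl⟩
  · exact (h n (by omega)).1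
  · exact (h n (by omega)).2

lemma entry_sum {ι : Type*} (s : Finset ι) (F : ι → CVec d) (m : ℤ) :
    entry (∑ i ∈ s, F i) m = ∑ i ∈ s, entry (F i) m := by
  unfold entry
  split_ifs <;> simp

lemma entry_uVec (ε : ℂ) (j : ℤ) {m : ℤ} (hm : |m| ≤ d) :
    entry (uVec d ε j) m =
      ((if m = j then 1 else 0) + ε * (-1) ^ d * (if m = -j then 1 else 0)) / 2 := by
  rw [entry, dif_pos (show m ∈ Set.Icc (-(d : ℤ)) d from abs_le.1 hm)]
  simp [uVec, vVec]
  ring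

/-- The sum of `c_j u^{d,ε}_{2j+δ}` over `0 ≤ 2j+δ ≤ d`. -/
noncomputable def uSum (d : ℕ) (c : ℕ → ℂ) (δ : ℕ) (ε : ℂ) : CVec d :=
  ∑ j ∈ (Finset.range (d + 1)).filter (fun j => 2 * j + δ ≤ d), c j • uVec d ε (2 * j + δ : ℕ)

lemma g2_eq_uSum (μ : Fin 3 → ℂ) (δ : ℕ) (ε : ℂ) : g2 d μ δ ε = uSum d (g2coef d μ δ) δ ε := rfl

lemma g3_eq_uSum (μ : Fin 3 → ℂ) (δ : ℕ) (ε : ℂ) : g3 d μ δ ε = uSum d (g3coef d μ δ) δ ε := rfl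

/-- The correction at index 0 is there because v_0 and v_{-0} coincide. -/
lemma entry_uSum (c : ℕ → ℂ) {δ : ℕ} (ε : ℂ) {J : ℕ} (hJ : 2 * J + δ ≤ d) :
    entry (uSum d c δ ε) (2 * J + δ : ℕ) =
      c J * ((1 + if 2 * J + δ = 0 then ε * (-1) ^ d else 0) / 2) := by
  rw [uSum, entry_sum, Finset.sum_eq_single J]
  · rw [entry_smul, entry_uVec _ _ (by rw [abs_le]; omega), if_pos rfl]
    by_cases h : 2 * J + δ = 0
    · rw [if_pos h, if_pos (by omega), mul_one]
    · rw [if_neg h, if_neg (by omega), mul_zero]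
  · intro j _ hj
    rw [entry_smul, entry_uVec _ _ (by rw [abs_le]; omega), if_neg (by omega), if_neg (by omega)]
    simp
  · intro h
    refine absurd ?_ h
    simp only [Finset.mem_filter, Finset.mem_range]
    omega

lemma entry_uSum_eq_zero (c : ℕ → ℂ) {δ : ℕ} (ε : ℂ) {n : ℕ} (hn : n ≤ d)
    (h : ∀ j, 2 * j + δ ≠ n) : entry (uSum d c δ ε) n = 0 := by
  rw [uSum, entry_sum]
  refine Finset.sum_eq_zero fun j _ => ?_
  have := h j
  rw [entry_smul, entry_uVec _ _ (by rw [abs_le]; omega), if_neg (by omega), if_neg (by omega)]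
  simp

/-- Reflection exchanges v_j and v_{-j}, so every u^{d,ε}_j is an eigenvector with eigenvalue s =
ε(-1)^d. -/
lemma entry_uSum_neg (c : ℕ → ℂ) {δ : ℕ} {ε s : ℂ} (hs : ε * (-1) ^ d = s) (hss : s * s = 1)
    {n : ℕ} (hn : n ≤ d) : entry (uSum d c δ ε) (-n) = s * entry (uSum d c δ ε) n := by
  rw [uSum, entry_sum, entry_sum, Finset.mul_sum]
  refine Finset.sum_congr rfl fun j _ => ?_
  rw [entry_smul, entry_smul, entry_uVec _ _ (by rw [abs_le]; omega),
    entry_uVec _ _ (by rw [abs_le]; omega), hs]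
  have e1 : (-(n : ℤ) = -((2 * j + δ : ℕ) : ℤ)) ↔ (n : ℤ) = (2 * j + δ : ℕ) := by omega
  have e2 : (-(n : ℤ) = ((2 * j + δ : ℕ) : ℤ)) ↔ (n : ℤ) = -(2 * j + δ : ℕ) := by omega
  simp only [e1, e2]
  linear_combination -(c j * (if (n : ℤ) = -(2 * j + δ : ℕ) then 1 else 0) / 2) * hss

/-- The product in the definition of `g2coef`. -/
noncomputable def ratioProd (d : ℕ) (μ : Fin 3 → ℂ) (k j : ℕ) : ℂ :=
  (-1) ^ j * ∏ i ∈ Finset.range j,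
    ((Real.sqrt (((d : ℝ) - 1 - 2 * i - k) * ((d : ℝ) - 2 * i - k)) : ℂ)
        * (3 * μ 2 + 2 * d - 1 + 2 * i + k)) /
      ((Real.sqrt (((d : ℝ) + 1 + 2 * i + k) * ((d : ℝ) + 2 + 2 * i + k)) : ℂ)
        * (μ 0 - μ 1 - 1 - 2 * i - k))

/-- The entries of `g2` of non-negative index; if `δ = 0` the sign has to be the even one. -/
lemma entry_uSum_of_eq_g2coef {c : ℕ → ℂ} {μ : Fin 3 → ℂ} {δ J : ℕ} {ε : ℂ}
    (hc : c J = g2coef d μ δ J) (h0 : δ = 0 → ε * (-1) ^ d = 1) (hJ : 2 * J + δ ≤ d) :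
    entry (uSum d c δ ε) (2 * J + δ : ℕ) = ratioProd d μ δ J / 2 := by
  rw [entry_uSum _ _ hJ, hc, g2coef]
  by_cases h : 2 * J + δ = 0
  · obtain rfl : J = 0 := by omega
    rw [if_pos h, if_pos h, h0 (by omega)]
    simp [ratioProd]
  · rw [if_neg h, if_neg h, ratioProd]
    ring

end Entries

/-! ### Propagation along a parity class -/

section Solutions

variable {d : ℕ} {μ : Fin 3 → ℂ} {f : CVec d}

lemma ratioProd_succ (k j : ℕ) : ratioProd d μ k (j + 1) = -ratioProd d μ k j *
    (((Real.sqrt (((d : ℝ) - 1 - 2 * j - k) * ((d : ℝ) - 2 * j - k)) : ℂ)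
        * (3 * μ 2 + 2 * d - 1 + 2 * j + k)) /
      ((Real.sqrt (((d : ℝ) + 1 + 2 * j + k) * ((d : ℝ) + 2 + 2 * j + k)) : ℂ)
        * (μ 0 - μ 1 - 1 - 2 * j - k))) := by
  rw [ratioProd, ratioProd, Finset.prod_range_succ, pow_succ]
  ring

/-- One step of the two-term recurrence, with the weights traded for square roots. It serves both
the positive and the negative half of the index range. -/
lemma ratio_step {x x' c : ℂ} {k j : ℕ} (hj : 2 * j + k + 2 ≤ d)
    (hne : μ 0 - μ 1 - 1 - 2 * j - k ≠ 0)
    (h : (μ 0 - μ 1 - 1 - (2 * j + k : ℕ)) * (weight d ((2 * j + k : ℕ) + 2) * x')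
      + (3 * μ 2 + 2 * d - 1 + (2 * j + k : ℕ)) * (weight d (2 * j + k : ℕ) * x) = 0)
    (hx : x = c * ratioProd d μ k j) : x' = c * ratioProd d μ k (j + 1) := by
  have hw := weight_add_two d (2 * j + k : ℕ) (by omega) (by omega)
  have hq : Real.sqrt (((d : ℝ) + 1 + 2 * j + k) * ((d : ℝ) + 2 + 2 * j + k)) ≠ 0 :=
    (Real.sqrt_pos.2 (by positivity)).ne'
  have er : ((d : ℤ) : ℝ) - 1 - ((2 * j + k : ℕ) : ℤ) = (d : ℝ) - 1 - 2 * j - k := by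
    push_cast; ring
  have er' : ((d : ℤ) : ℝ) - ((2 * j + k : ℕ) : ℤ) = (d : ℝ) - 2 * j - k := by push_cast; ring
  have eq : ((d : ℤ) : ℝ) + 1 + ((2 * j + k : ℕ) : ℤ) = (d : ℝ) + 1 + 2 * j + k := by
    push_cast; ring
  have eq' : ((d : ℤ) : ℝ) + 2 + ((2 * j + k : ℕ) : ℤ) = (d : ℝ) + 2 + 2 * j + k := by
    push_cast; ring
  rw [er, er', eq, eq'] at hw
  have hq' := Complex.ofReal_ne_zero.2 hq
  have hw' := congrArg Complex.ofReal hw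
  push_cast at hw' h
  have hW := weight_ne_zero d ((2 * j + k : ℕ) + 2)
  push_cast at hW
  rw [ratioProd_succ]
  generalize (Real.sqrt (((d : ℝ) - 1 - 2 * j - k) * ((d : ℝ) - 2 * j - k)) : ℂ) = r at *
  generalize (Real.sqrt (((d : ℝ) + 1 + 2 * j + k) * ((d : ℝ) + 2 + 2 * j + k)) : ℂ) = q at *
  generalize (weight d (2 * j + k + 2) : ℂ) = W' at *
  generalize (weight d (2 * j + k) : ℂ) = W at *
  subst hx
  rw [mul_div_assoc', mul_div_assoc', eq_div_iff (mul_ne_zero hq' hne)]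
  refine mul_left_cancel₀ hW ?_
  linear_combination q * h + (3 * μ 2 + 2 * d - 1 + 2 * j + k) * c * ratioProd d μ k j * hw'

/-- The entries of a solution along `k, k + 2, …` and `-k, -k - 2, …` are determined by the
first one, as long as no denominator vanishes. -/
lemma entry_progression (hd : 2 ≤ d) (hμ : μ 0 + μ 1 + μ 2 = 0)
    (h1 : YMu d (-1) μ f = 0) (h2 : YMu d (-2) μ f = 0) {k N : ℕ} (hN : N ≤ d)
    (hne : ∀ j : ℕ, 2 * j + k + 2 ≤ N → μ 0 - μ 1 - 1 - 2 * j - k ≠ 0) (j : ℕ)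
    (hj : 2 * j + k ≤ N) :
    entry f (2 * j + k : ℕ) = entry f k * ratioProd d μ k j ∧
      entry f (-(2 * j + k : ℕ)) = entry f (-k) * ratioProd d μ k j := by
  induction j with
  | zero => simp [ratioProd]
  | succ j ih =>
    obtain ⟨i1, i2⟩ := ih (by omega)
    have hn := hne j (by omega)
    have e : ((2 * (j + 1) + k : ℕ) : ℤ) = (2 * j + k : ℕ) + 2 := by push_cast; ring
    rw [e]
    constructor
    · have t := two_term_add hd hμ h1 h2 (m := (2 * j + k : ℕ)) (by omega) (by omega)
      rw [scaledEntry, scaledEntry, Int.cast_natCast] at t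
      exact ratio_step (by omega) hn t i1
    -- Under m ↦ -m this relation has the same coefficients as the previous one, so both halves
    -- share the same ratios.
    · have t := two_term_sub hd hμ h1 h2 (m := -(2 * j + k : ℕ)) (by omega) (by omega)
      have e' : -((2 * j + k : ℕ) : ℤ) - 2 = -((2 * j + k : ℕ) + 2) := by ring
      rw [e', scaledEntry, scaledEntry, weight_neg, weight_neg, Int.cast_neg,
        Int.cast_natCast] at t
      refine ratio_step (by omega) hn ?_ i2
      linear_combination t

end Solutions

/-! ### Integrality conditions on unitary parameters -/

section Parameters

variable {μ : Fin 3 → ℂ}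

lemma UnitaryStandardForm.sum_eq_zero (h : UnitaryStandardForm μ) : μ 0 + μ 1 + μ 2 = 0 := by
  rcases h with ⟨t1, t2, -, -, -, rfl⟩ | ⟨x, t, -, rfl⟩ <;> simp <;> ring

/-- In the first family all differences are purely imaginary. In the second μ₀ - μ₂ = 2x, which
leaves t free. -/
lemma UnitaryStandardForm.of_sub_zero_two (h : UnitaryStandardForm μ) {r : ℝ} (hr : r ≠ 0)
    (e : μ 0 - μ 2 = r) :
    ∃ t : ℝ, μ = ![(r : ℂ) / 2 + Complex.I * t, -2 * Complex.I * t,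
      -((r : ℂ) / 2) + Complex.I * t] := by
  rcases h with ⟨t1, t2, -, -, -, rfl⟩ | ⟨x, t, -, rfl⟩
  · have := congrArg Complex.re e
    simp at this
    exact absurd this.symm hr
  · refine ⟨t, ?_⟩
    have := congrArg Complex.re e
    simp at this
    obtain rfl : r = 2 * x := by linarith
    push_cast
    simp

/-- Here the difference is x - 3it, so being real also forces t = 0. -/
lemma UnitaryStandardForm.of_sub_one_two (h : UnitaryStandardForm μ) {r : ℝ} (hr : r ≠ 0)
    (e : μ 1 - μ 2 = r) : μ = ![(r : ℂ), 0, -r] := by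
  rcases h with ⟨t1, t2, -, -, -, rfl⟩ | ⟨x, t, -, rfl⟩
  · have := congrArg Complex.re e
    simp at this
    exact absurd this.symm hr
  · have e1 := congrArg Complex.re e
    have e2 := congrArg Complex.im e
    simp at e1 e2
    obtain rfl : t = 0 := by linarith
    obtain rfl : x = r := by linarith
    simp

lemma UnitaryStandardForm.of_sub_zero_one (h : UnitaryStandardForm μ) {r : ℝ} (hr : r ≠ 0)
    (e : μ 0 - μ 1 = r) : μ = ![(r : ℂ), 0, -r] := by
  rcases h with ⟨t1, t2, -, -, -, rfl⟩ | ⟨x, t, -, rfl⟩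
  · have := congrArg Complex.re e
    simp at this
    exact absurd this.symm hr
  · have e1 := congrArg Complex.re e
    have e2 := congrArg Complex.im e
    simp at e1 e2
    obtain rfl : t = 0 := by linarith
    obtain rfl : x = r := by linarith
    simp

end Parameters

/-! ### Solution spaces in the degenerate and generic cases -/

section Solutions

variable {d : ℕ} {μ : Fin 3 → ℂ} {f : CVec d}

/-- This links the positive and negative halves of the odd class: if A = B ≠ 0 it gives f_{-1} =
-f_1, and if A = -B ≠ 0 it gives f_{-1} = f_1. -/
lemma entry_neg_one (hd : 2 ≤ d) (hμ : μ 0 + μ 1 + μ 2 = 0)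
    (h1 : YMu d (-1) μ f = 0) (h2 : YMu d (-2) μ f = 0) :
    (μ 0 - μ 1) * entry f 1 + (3 * μ 2 + 2 * d - 2) * entry f (-1) = 0 := by
  have t := two_term_add hd hμ h1 h2 (m := -1) (by omega) (by omega)
  rw [scaledEntry, scaledEntry, weight_neg] at t
  norm_num at t
  refine (mul_eq_zero.1 ?_).resolve_left (weight_ne_zero d 1)
  linear_combination t

/-- On a parity class without vanishing denominators a solution is a multiple of `g2`. -/
lemma entry_eq_mul_entry_uSum (hd : 2 ≤ d) (hμ : μ 0 + μ 1 + μ 2 = 0)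
    (h1 : YMu d (-1) μ f = 0) (h2 : YMu d (-2) μ f = 0) {δ N : ℕ} (hN : N ≤ d)
    (hne : ∀ j : ℕ, 2 * j + δ + 2 ≤ N → μ 0 - μ 1 - 1 - 2 * j - δ ≠ 0) {c : ℕ → ℂ} {j : ℕ}
    (hj : 2 * j + δ ≤ N) (hc : c j = g2coef d μ δ j) {ε s : ℂ} (hs : ε * (-1) ^ d = s)
    (hss : s * s = 1) (h0 : δ = 0 → s = 1) (hf : entry f (-δ) = s * entry f δ) :
    entry f (2 * j + δ : ℕ) = 2 * entry f δ * entry (uSum d c δ ε) (2 * j + δ : ℕ) ∧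
      entry f (-(2 * j + δ : ℕ)) = 2 * entry f δ * entry (uSum d c δ ε) (-(2 * j + δ : ℕ)) := by
  obtain ⟨e1, e2⟩ := entry_progression hd hμ h1 h2 hN hne j hj
  rw [entry_uSum_neg c hs hss (by omega), e1, e2, hf,
    entry_uSum_of_eq_g2coef hc (fun h => hs.trans (h0 h)) (by omega)]
  constructor <;> ring

/-- The case `μ₀ - μ₂ = d - 1` without vanishing denominators. -/
lemma mem_span_g2 (hd : 2 ≤ d) (hμ : μ 0 + μ 1 + μ 2 = 0)
    (h1 : YMu d (-1) μ f = 0) (h2 : YMu d (-2) μ f = 0)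
    (hA : 3 * μ 2 + 2 * d - 2 = μ 0 - μ 1) (h0 : μ 0 - μ 1 ≠ 0)
    (hne : ∀ n : ℕ, μ 0 - μ 1 - 1 - n ≠ 0) :
    f ∈ Submodule.span ℂ {g2 d μ 0 ((-1) ^ d), g2 d μ 1 (-(-1) ^ d)} := by
  have hf : entry f (-1) = -1 * entry f 1 := by
    have := entry_neg_one hd hμ h1 h2
    rw [hA, ← mul_add] at this
    linear_combination (mul_eq_zero.1 this).resolve_left h0
  have hs0 : ((-1 : ℂ)) ^ d * (-1) ^ d = 1 := by rw [← mul_pow]; simp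
  have hs1 : -((-1 : ℂ)) ^ d * (-1) ^ d = -1 := by rw [neg_mul, hs0]
  have hne' : ∀ δ j : ℕ, 2 * j + δ + 2 ≤ d → μ 0 - μ 1 - 1 - 2 * j - δ ≠ 0 := fun δ j _ => by
    have := hne (2 * j + δ)
    push_cast at this
    rwa [← sub_sub] at this
  -- Each g₂ has first entry 1/2, whence the factors 2.
  refine Submodule.mem_span_pair.2 ⟨2 * entry f 0, 2 * entry f 1, (cvec_ext fun n hn => ?_)⟩
  rw [g2_eq_uSum, g2_eq_uSum]
  simp only [entry_add, entry_smul]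
  rcases Nat.even_or_odd' n with ⟨j, rfl | rfl⟩
  · obtain ⟨e1, e2⟩ := entry_eq_mul_entry_uSum (δ := 0) (j := j) hd hμ h1 h2 le_rfl (hne' 0) hn
      rfl hs0 (by simp) (fun _ => rfl) (by simp)
    have z := entry_uSum_eq_zero (g2coef d μ 1) (δ := 1) (-(-1) ^ d) hn (by omega)
    rw [entry_uSum_neg _ hs1 (by simp) hn, z]
    simp only [add_zero, Nat.cast_zero] at e1 e2
    rw [e1, e2]
    simp
  · obtain ⟨e1, e2⟩ := entry_eq_mul_entry_uSum (δ := 1) (j := j) hd hμ h1 h2 le_rfl (hne' 1) hn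
      rfl hs1 (by simp) (by simp) hf
    have z := entry_uSum_eq_zero (g2coef d μ 0) (δ := 0) ((-1) ^ d) hn (by omega)
    rw [entry_uSum_neg _ hs0 (by simp) hn, z, e1, e2]
    simp

/-- The case `μ₁ - μ₂ = d - 1`. -/
lemma mem_span_g3 (hd : 2 ≤ d) (hμ : μ 0 + μ 1 + μ 2 = 0)
    (h1 : YMu d (-1) μ f = 0) (h2 : YMu d (-2) μ f = 0)
    (hA : μ 0 - μ 1 = d - 1) (hB : 3 * μ 2 + 2 * d - 2 = 1 - d) :
    f ∈ Submodule.span ℂ {g3 d μ 1 ((-1) ^ d), g3 d μ 0 ((-1) ^ d), uVec d 1 d, uVec d (-1) d} := by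
  have hd1 : (d : ℂ) - 1 ≠ 0 := by
    rw [sub_ne_zero]
    exact_mod_cast (by omega : d ≠ 1)
  have hf : entry f (-1) = 1 * entry f 1 := by
    have := entry_neg_one hd hμ h1 h2
    rw [hA, hB] at this
    refine mul_left_cancel₀ hd1 ?_
    linear_combination -this
  have hs : ((-1 : ℂ)) ^ d * (-1) ^ d = 1 := by rw [← mul_pow]; simp
  -- The denominator d - 2 - m vanishes only at m = d - 2, so propagation is used up to index d - 1
  -- only.
  have hne : ∀ δ j : ℕ, 2 * j + δ + 2 ≤ d - 1 → μ 0 - μ 1 - 1 - 2 * j - δ ≠ 0 := fun δ j h => by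
    rw [hA]
    have : (d : ℂ) ≠ (2 + 2 * j + δ : ℕ) := by exact_mod_cast (by omega : d ≠ 2 + 2 * j + δ)
    intro h
    apply this
    push_cast
    linear_combination h
  have hc : ∀ δ j : ℕ, 2 * j + δ < d → g3coef d μ δ j = g2coef d μ δ j := fun δ j h => by
    rw [g3coef, if_neg h.ne]
  set b := 2 * entry f 1 with hb
  set c := 2 * entry f 0 with hcdef
  set r := b • g3 d μ 1 ((-1) ^ d) + c • g3 d μ 0 ((-1) ^ d) with hr
  -- The two vectors u_d^± span the entries at ±d, so they absorb any discrepancy there. The special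
  -- last coefficient of g₃ plays no role.
  set p := entry f d - entry r d with hp
  set q := (-1) ^ d * (entry f (-d) - entry r (-d)) with hq
  have key : f = b • g3 d μ 1 ((-1) ^ d) + c • g3 d μ 0 ((-1) ^ d) +
      (p + q) • uVec d 1 d + (p - q) • uVec d (-1) d := by
    rw [← hr]
    refine cvec_ext fun n hn => ?_
    simp only [entry_add, entry_smul]
    rw [entry_uVec _ _ (by rw [abs_le]; omega), entry_uVec _ _ (by rw [abs_le]; omega),
      entry_uVec _ _ (by rw [abs_le]; omega), entry_uVec _ _ (by rw [abs_le]; omega)]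
    rcases hn.lt_or_eq with hlt | rfl
    · rw [if_neg (by omega), if_neg (by omega), if_neg (by omega), if_neg (by omega)]
      simp only [mul_zero, add_zero, zero_div, hr, entry_add, entry_smul]
      rw [g3_eq_uSum, g3_eq_uSum, hb, hcdef]
      rcases Nat.even_or_odd' n with ⟨j, rfl | rfl⟩
      · obtain ⟨e1, e2⟩ := entry_eq_mul_entry_uSum (δ := 0) (j := j) hd hμ h1 h2
          (Nat.sub_le d 1) (hne 0) (by omega) (hc 0 j (by omega)) hs (by simp) (fun _ => rfl)
          (by simp)
        have z := entry_uSum_eq_zero (g3coef d μ 1) (δ := 1) ((-1) ^ d) hn (by omega)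
        rw [entry_uSum_neg _ hs (δ := 1) (by simp) hn, z]
        simp only [add_zero, Nat.cast_zero] at e1 e2
        rw [e1, e2]
        simp
      · obtain ⟨e1, e2⟩ := entry_eq_mul_entry_uSum (δ := 1) (j := j) hd hμ h1 h2
          (Nat.sub_le d 1) (hne 1) (by omega) (hc 1 j (by omega)) hs (by simp) (by simp) hf
        have z := entry_uSum_eq_zero (g3coef d μ 0) (δ := 0) ((-1) ^ d) hn (by omega)
        rw [entry_uSum_neg _ hs (δ := 0) (by simp) hn, z, e1, e2]
        simp
    · rw [if_pos rfl, if_neg (by omega), if_neg (by omega), if_pos rfl]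
      constructor
      · linear_combination -hp
      · linear_combination -(-1) ^ n * hq - (entry f (-n) - entry r (-n)) * hs
  rw [key]
  refine add_mem (add_mem (add_mem ?_ ?_) ?_) ?_ <;>
    exact Submodule.smul_mem _ _ (Submodule.subset_span (by simp))

/-- If `μ₀ - μ₁ = κ - 1` then the entries of index `m ≡ κ`, `|m| < κ`, vanish. -/
lemma entry_eq_zero_of_lt (hd : 2 ≤ d) (hμ : μ 0 + μ 1 + μ 2 = 0)
    (h1 : YMu d (-1) μ f = 0) (h2 : YMu d (-2) μ f = 0)
    (hA : 3 * μ 2 + 2 * d - 2 = μ 0 - μ 1) {κ : ℕ} (hκ : κ < d) (hκA : μ 0 - μ 1 = κ - 1)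
    {i : ℕ} (hi : i + 2 ≤ κ) : entry f (κ - 2 - 2 * i) = 0 := by
  have hκ1 : (κ : ℂ) - 1 ≠ 0 := by
    rw [sub_ne_zero]
    exact_mod_cast (by omega : κ ≠ 1)
  have step : ∀ m : ℤ, 2 - d ≤ m → m ≤ d - 1 → (κ - 2 + m : ℂ) * scaledEntry f (m - 2)
      + (κ - m) * scaledEntry f m = 0 := fun m l u => by
    have t := two_term_sub hd hμ h1 h2 (m := m) l u
    linear_combination t + (-scaledEntry f (m - 2) - scaledEntry f m) * hκA
      - scaledEntry f m * hA
  rw [← scaledEntry_eq_zero_iff]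
  induction i with
  | zero =>
    -- At m = κ the coefficient of h_κ is zero and that of h_{κ-2} is 2(κ - 1).
    have t := step κ (by omega) (by omega)
    have e : (κ : ℤ) - 2 - 2 * (0 : ℕ) = κ - 2 := by simp
    rw [e]
    refine (mul_eq_zero.1 ?_).resolve_left hκ1
    push_cast at t
    linear_combination t / 2
  | succ i ih =>
    -- The vanishing descends: the next coefficient is 2(κ - 2 - i), nonzero until index 2 - κ has
    -- been reached.
    have t := step (κ - 2 - 2 * i) (by omega) (by omega)
    rw [ih (by omega)] at t
    have e : (κ : ℤ) - 2 - 2 * (i + 1 : ℕ) = κ - 2 - 2 * i - 2 := by push_cast; ring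
    rw [e]
    have hne : (κ : ℂ) - 2 - i ≠ 0 := by
      have : (κ : ℂ) ≠ (2 + i : ℕ) := by exact_mod_cast (by omega : κ ≠ 2 + i)
      intro h
      apply this
      push_cast
      linear_combination h
    refine (mul_eq_zero.1 ?_).resolve_left hne
    push_cast at t
    linear_combination t / 2

/-- The case `μ = ((d-1)/2, 0, -(d-1)/2)` with `d` odd. -/
lemma mem_span_g2_g4 (hd : 2 ≤ d) (hμ : μ 0 + μ 1 + μ 2 = 0)
    (h1 : YMu d (-1) μ f = 0) (h2 : YMu d (-2) μ f = 0)
    (hA : 3 * μ 2 + 2 * d - 2 = μ 0 - μ 1) {κ δ : ℕ} (hκ : d + 1 = 2 * κ) (hδ : δ < 2)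
    (hδκ : δ ≡ κ + 1 [MOD 2]) (hκA : μ 0 - μ 1 = κ - 1) :
    f ∈ Submodule.span ℂ {g2 d μ δ ((-1) ^ κ), g4 d μ 1, g4 d μ (-1)} := by
  have hodd : Odd d := ⟨κ - 1, by omega⟩
  have hd' : (-1 : ℂ) ^ d = -1 := hodd.neg_one_pow
  have hκ' : (d + 1) / 2 = κ := by omega
  unfold Nat.ModEq at hδκ
  have hg4 : ∀ ε, g4 d μ ε = uSum d (g2coef d μ κ) κ ε := fun ε => by rw [g4, hκ']; rfl
  obtain ⟨s, hs, hss, hs0, hf⟩ : ∃ s : ℂ, (-1) ^ κ * (-1) ^ d = s ∧ s * s = 1 ∧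
      (δ = 0 → s = 1) ∧ entry f (-δ) = s * entry f δ := by
    rcases (by omega : δ = 0 ∨ δ = 1) with rfl | rfl
    · refine ⟨1, ?_, by simp, fun _ => rfl, by simp⟩
      have : Odd κ := by rw [Nat.odd_iff]; omega
      rw [hd', this.neg_one_pow]
      simp
    · refine ⟨-1, ?_, by simp, by simp, ?_⟩
      · have : Even κ := by rw [Nat.even_iff]; omega
        rw [hd', this.neg_one_pow]
        simp
      · have h0 : μ 0 - μ 1 ≠ 0 := by
          rw [hκA, sub_ne_zero]
          exact_mod_cast (by omega : κ ≠ 1)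
        have := entry_neg_one hd hμ h1 h2
        rw [hA, ← mul_add] at this
        push_cast
        linear_combination (mul_eq_zero.1 this).resolve_left h0
  -- The only zero denominator is at m = κ - 2, which has the parity opposite to δ.
  have hneδ : ∀ j : ℕ, 2 * j + δ + 2 ≤ d → μ 0 - μ 1 - 1 - 2 * j - δ ≠ 0 := fun j _ => by
    have : (κ : ℂ) ≠ (2 * j + δ + 2 : ℕ) := by exact_mod_cast (by omega : κ ≠ 2 * j + δ + 2)
    intro h
    apply this
    push_cast
    linear_combination h - hκA
  have hneκ : ∀ j : ℕ, 2 * j + κ + 2 ≤ d → μ 0 - μ 1 - 1 - 2 * j - κ ≠ 0 := fun j _ => by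
    rw [hκA]
    have : ((2 * j + 2 : ℕ) : ℂ) ≠ 0 := by exact_mod_cast (by omega : 2 * j + 2 ≠ 0)
    intro h
    apply this
    push_cast
    linear_combination -h
  -- The entries at κ and -κ are independent. Since d is odd, g₄^+ is odd and g₄^- is even under
  -- reflection, which explains the difference and the sum.
  have key : f = (2 * entry f δ) • g2 d μ δ ((-1) ^ κ) +
      (entry f κ - entry f (-κ)) • g4 d μ 1 + (entry f κ + entry f (-κ)) • g4 d μ (-1) := by
    refine cvec_ext fun n hn => ?_
    rw [g2_eq_uSum, hg4, hg4]
    simp only [entry_add, entry_smul]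
    rw [entry_uSum_neg (δ := κ) (s := -1) _ (by rw [hd']; simp) (by simp) hn,
      entry_uSum_neg (δ := κ) (s := 1) _ (by rw [hd']; simp) (by simp) hn]
    by_cases hpar : n % 2 = δ
    · obtain ⟨j, rfl⟩ : ∃ j, n = 2 * j + δ := ⟨n / 2, by omega⟩
      obtain ⟨e1, e2⟩ := entry_eq_mul_entry_uSum (δ := δ) (j := j) hd hμ h1 h2 le_rfl hneδ hn
        rfl hs hss hs0 hf
      rw [e1, e2, entry_uSum_eq_zero (δ := κ) _ _ hn (by omega),
        entry_uSum_eq_zero (δ := κ) _ _ hn (by omega)]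
      simp
    · rw [entry_uSum_neg (δ := δ) _ hs hss hn, entry_uSum_eq_zero (δ := δ) _ _ hn (by omega)]
      by_cases hlt : n < κ
      · rw [entry_uSum_eq_zero (δ := κ) _ _ hn (by omega),
          entry_uSum_eq_zero (δ := κ) _ _ hn (by omega)]
        have z : ∀ m : ℤ, -κ < m → m < κ → (κ - m) % 2 = 0 → entry f m = 0 := fun m l u e => by
          obtain ⟨i, hi⟩ : ∃ i : ℕ, m = κ - 2 - 2 * i := ⟨((κ - 2 - m) / 2).toNat, by omega⟩
          rw [hi]
          exact entry_eq_zero_of_lt hd hμ h1 h2 hA (by omega) hκA (by omega)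
        rw [z n (by omega) (by omega) (by omega), z (-n) (by omega) (by omega) (by omega)]
        simp
      · obtain ⟨j, rfl⟩ : ∃ j, n = 2 * j + κ := ⟨(n - κ) / 2, by omega⟩
        obtain ⟨e1, e2⟩ := entry_progression hd hμ h1 h2 le_rfl hneκ j hn
        rw [entry_uSum_of_eq_g2coef (δ := κ) rfl (by omega) hn,
          entry_uSum_of_eq_g2coef (δ := κ) rfl (by omega) hn, e1, e2]
        constructor <;> ring
  rw [key]
  refine add_mem (add_mem ?_ ?_) ?_ <;>
    exact Submodule.smul_mem _ _ (Submodule.subset_span (by simp))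

/-- If the determinant of the two relations between `h_{m-2}` and `h_m` is nonzero, then both
vanish. -/
lemma entry_eq_zero_of_det_ne_zero (hd : 2 ≤ d) (hμ : μ 0 + μ 1 + μ 2 = 0)
    (h1 : YMu d (-1) μ f = 0) (h2 : YMu d (-2) μ f = 0)
    (hdet : (μ 0 - μ 1) ^ 2 - (3 * μ 2 + 2 * d - 2) ^ 2 ≠ 0) {m : ℤ} (hm : 3 - d ≤ m)
    (hm' : m ≤ d - 1) : entry f (m - 2) = 0 ∧ entry f m = 0 := by
  have t1 := two_term_sub hd hμ h1 h2 (m := m) (by omega) hm'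
  have t2 := two_term_add hd hμ h1 h2 (m := m - 2) (by omega) (by omega)
  rw [sub_add_cancel] at t2
  push_cast at t2
  rw [← scaledEntry_eq_zero_iff, ← scaledEntry_eq_zero_iff]
  constructor <;> refine (mul_eq_zero.1 ?_).resolve_left hdet
  · linear_combination (μ 0 - μ 1 + 1 - m) * t1 - (3 * μ 2 + 2 * d - 1 - m) * t2
  · linear_combination (μ 0 - μ 1 - 1 + m) * t2 - (3 * μ 2 + 2 * d - 3 + m) * t1

/-- For d ≥ 3 every index |m| < d belongs to a pair satisfying both relations. The entries at ±d
occur in one relation each, with coefficient A + 1 - d. -/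
lemma eq_zero_of_det_ne_zero (hd : 3 ≤ d) (hμ : μ 0 + μ 1 + μ 2 = 0)
    (h1 : YMu d (-1) μ f = 0) (h2 : YMu d (-2) μ f = 0)
    (hdet : (μ 0 - μ 1) ^ 2 - (3 * μ 2 + 2 * d - 2) ^ 2 ≠ 0) (hA : μ 0 - μ 1 + 1 - d ≠ 0) :
    f = 0 := by
  have z : ∀ m : ℤ, 1 - d ≤ m → m ≤ d - 1 → entry f m = 0 := fun m l u => by
    by_cases hm : 3 - d ≤ m
    · exact (entry_eq_zero_of_det_ne_zero (by omega) hμ h1 h2 hdet hm u).2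
    · have := (entry_eq_zero_of_det_ne_zero (m := m + 2) (by omega) hμ h1 h2 hdet (by omega)
        (by omega)).1
      rwa [add_sub_cancel_right] at this
  have z0 : ∀ m : ℤ, entry (0 : CVec d) m = 0 := fun m => by unfold entry; split_ifs <;> rfl
  refine cvec_ext fun n hn => ?_
  rw [z0, z0]
  rcases hn.lt_or_eq with hlt | rfl
  · exact ⟨z _ (by omega) (by omega), z _ (by omega) (by omega)⟩
  · have t1 := two_term_sub (by omega) hμ h1 h2 (m := 2 - n) (by omega) (by omega)
    have t2 := two_term_add (by omega) hμ h1 h2 (m := n - 2) (by omega) (by omega)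
    rw [(scaledEntry_eq_zero_iff f _).2 (z (2 - n) (by omega) (by omega))] at t1
    rw [(scaledEntry_eq_zero_iff f _).2 (z (n - 2) (by omega) (by omega))] at t2
    rw [sub_add_cancel] at t2
    rw [show (2 : ℤ) - n - 2 = -n by ring] at t1
    push_cast at t1 t2
    rw [← scaledEntry_eq_zero_iff, ← scaledEntry_eq_zero_iff]
    constructor <;> refine (mul_eq_zero.1 ?_).resolve_left hA
    · linear_combination t2
    · linear_combination t1

/-- For d = 2 only the pair (-1, 1) satisfies both relations. The entries at ±2 are determined by
f_0 through one relation each, so a line of solutions survives. -/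
lemma eq_smul_g1 {f : CVec (2 : ℕ)} (hμ : μ 0 + μ 1 + μ 2 = 0)
    (h1 : YMu (2 : ℕ) (-1) μ f = 0) (h2 : YMu (2 : ℕ) (-2) μ f = 0)
    (hdet : (μ 0 - μ 1) ^ 2 - (3 * μ 2 + 2 * (2 : ℕ) - 2) ^ 2 ≠ 0) (hA : μ 0 - μ 1 - 1 ≠ 0) :
    ∃ c : ℂ, f = c • g1 2 μ := by
  obtain ⟨zn, zp⟩ := entry_eq_zero_of_det_ne_zero (m := 1) le_rfl hμ h1 h2 hdet (by simp) (by simp)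
  have t1 := two_term_sub le_rfl hμ h1 h2 (m := 0) (by simp) (by simp)
  have t2 := two_term_add le_rfl hμ h1 h2 (m := 0) (by simp) (by simp)
  have w2 : weight (2 : ℕ) 2 = 2 * Real.sqrt 6 := by
    rw [← sqrt_ifact_two, weight, mul_comm]
    norm_num
  have w0 : weight (2 : ℕ) 0 = 2 := by
    rw [← sqrt_ifact_zero, weight]
    norm_num
  rw [scaledEntry, scaledEntry, zero_sub, weight_neg, w2, w0] at t1
  rw [scaledEntry, scaledEntry, zero_add, w2, w0] at t2
  push_cast at t1 t2
  have h6 := sqrt_six_sq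
  have h60 := sqrt_six_ne_zero
  refine ⟨entry f 0 / (μ 0 - μ 1 - 1), cvec_ext fun n hn => ?_⟩
  rw [g1]
  simp only [entry_add, entry_smul]
  interval_cases n <;>
    (repeat rw [entry_uVec _ _ (by norm_num)]) <;> norm_num at zn ⊢
  · field_simp
  · exact ⟨zp, zn⟩
  · rw [div_mul_eq_mul_div, ← neg_div, eq_div_iff hA, eq_div_iff hA]
    constructor <;> refine mul_left_cancel₀ h60 ?_
    · linear_combination t2 / 2 + entry f 0 * (1 + μ 2) / 2 * h6
    · linear_combination t1 / 2 + entry f 0 * (1 + μ 2) / 2 * h6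

end Solutions

end GLThree

/-! ### Case distinction on the parameters -/

theorem mainTheorem5 (d : ℕ) (μ : Fin 3 → ℂ) (hμ : GLThree.UnitaryStandardForm μ)
    (f : GLThree.CVec d)
    (h1 : GLThree.YMu d (-1) μ f = 0) (h2 : GLThree.YMu d (-2) μ f = 0) :
    f = 0 ∨
    (d = 0 ∨ d = 1) ∨
    (d = 2 ∧ ∃ c : ℂ, f = c • GLThree.g1 d μ) ∨
    (∃ t : ℝ, (Even d ∨ t ≠ 0) ∧
      μ = ![((d : ℂ) - 1) / 2 + Complex.I * t, -2 * Complex.I * t,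
            -(((d : ℂ) - 1) / 2) + Complex.I * t] ∧
      f ∈ Submodule.span ℂ {GLThree.g2 d μ 0 ((-1) ^ d), GLThree.g2 d μ 1 (-(-1) ^ d)}) ∨
    (Odd d ∧ μ = ![((d : ℂ) - 1) / 2, 0, -(((d : ℂ) - 1) / 2)] ∧
      ∃ κ δ : ℕ, κ = (d + 1) / 2 ∧ δ < 2 ∧ δ ≡ κ + 1 [MOD 2] ∧
        f ∈ Submodule.span ℂ
          {GLThree.g2 d μ δ ((-1) ^ κ), GLThree.g4 d μ 1, GLThree.g4 d μ (-1)}) ∨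
    (μ = ![(d : ℂ) - 1, 0, 1 - (d : ℂ)] ∧
      f ∈ Submodule.span ℂ
        {GLThree.g3 d μ 1 ((-1) ^ d), GLThree.g3 d μ 0 ((-1) ^ d),
         GLThree.uVec d 1 d, GLThree.uVec d (-1) d}) := by
  have hs := hμ.sum_eq_zero
  by_cases hd01 : d = 0 ∨ d = 1
  · exact Or.inr (Or.inl hd01)
  have hd : 2 ≤ d := by omega
  have hr : (d : ℝ) - 1 ≠ 0 := by
    rw [sub_ne_zero]
    exact_mod_cast (by omega : d ≠ 1)
  by_cases hi : μ 0 - μ 2 = ((d - 1 : ℝ) : ℂ)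
  · obtain ⟨t, ht⟩ := hμ.of_sub_zero_two hr hi
    push_cast at ht
    have hB : 3 * μ 2 + 2 * d - 2 = μ 0 - μ 1 := by
      push_cast at hi
      linear_combination -2 * hi + hs
    have hA : μ 0 - μ 1 = (d - 1) / 2 + 3 * Complex.I * t := by
      rw [ht]
      simp
      ring
    by_cases hc : Even d ∨ t ≠ 0
    · refine Or.inr (Or.inr (Or.inr (Or.inl
        ⟨t, hc, ht, GLThree.mem_span_g2 hd hs h1 h2 hB ?_ fun n => ?_⟩)))
      · intro h
        have := congrArg Complex.re (hA.symm.trans h)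
        simp at this
        exact hr this
      · intro h
        have e := hA.symm.trans (by linear_combination h : μ 0 - μ 1 = n + 1)
        have e1 := congrArg Complex.re e
        have e2 := congrArg Complex.im e
        simp at e1 e2
        -- A zero denominator would need d = 2n + 3 (real part) and t = 0 (imaginary part).
        rcases hc with ⟨k, rfl⟩ | hc
        · have : ((k + k : ℕ) : ℝ) = (2 * n + 3 : ℕ) := by push_cast at e1 ⊢; linarith
          have : k + k = 2 * n + 3 := by exact_mod_cast this
          omega
        · exact hc e2
    · push Not at hc
      obtain ⟨ho, rfl⟩ := hc
      rw [Nat.not_even_iff_odd] at ho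
      obtain ⟨k, rfl⟩ := ho
      refine Or.inr (Or.inr (Or.inr (Or.inr (Or.inl ⟨⟨k, rfl⟩, ?_, k + 1, k % 2, by omega,
        by omega, ?_, GLThree.mem_span_g2_g4 hd hs h1 h2 hB (by omega) (by omega) ?_ ?_⟩))))
      · rw [ht]
        simp
      · unfold Nat.ModEq
        omega
      · unfold Nat.ModEq
        omega
      · rw [hA]
        push_cast
        ring
  by_cases hii : μ 1 - μ 2 = ((d - 1 : ℝ) : ℂ)
  · have hv := hμ.of_sub_one_two hr hii
    push_cast at hv
    refine Or.inr (Or.inr (Or.inr (Or.inr (Or.inr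
      ⟨by simpa using hv, GLThree.mem_span_g3 hd hs h1 h2 ?_ ?_⟩))))
    · rw [hv]
      simp
    · rw [hv]
      simp
      ring
  have hdet : (μ 0 - μ 1) ^ 2 - (3 * μ 2 + 2 * d - 2) ^ 2 ≠ 0 := by
    push_cast at hi hii
    have e1 := sub_ne_zero.2 hi
    have e2 := sub_ne_zero.2 hii
    intro h
    refine mul_ne_zero e1 e2 ?_
    have : μ 1 = -μ 0 - μ 2 := by linear_combination hs
    rw [this] at h ⊢
    linear_combination -h / 4
  -- For unitary parameters A = d - 1 forces μ = (d-1, 0, 1-d), which already falls under μ₁ - μ₂ =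
  -- d - 1.
  have hA : μ 0 - μ 1 ≠ ((d - 1 : ℝ) : ℂ) := fun h => by
    refine hii ?_
    rw [hμ.of_sub_zero_one hr h]
    simp
  push_cast at hA
  rcases hd.lt_or_eq with hd3 | rfl
  · refine Or.inl (GLThree.eq_zero_of_det_ne_zero hd3 hs h1 h2 hdet fun h => hA ?_)
    linear_combination h
  · refine Or.inr (Or.inr (Or.inl ⟨rfl, GLThree.eq_smul_g1 hs h1 h2 hdet fun h => hA ?_⟩))
    push_cast
    linear_combination h
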